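/- Let $n\ge 0$, $d\ge 1$, and let $\{e_a\}_{a\in\mathbb{Z}_{d^2}}$ be an orthogonal basis of the complex $d\times d$ matrices with $\mathrm{Tr}(e_a^\dagger e_b)=d\,\delta_{ab}$ and $I_d\in\{e_a\}$. For $\alpha\in\mathbb{Z}_{d^2}^n$ put $E_\alpha=e_{\alpha_1}\otimes\cdots\otimes e_{\alpha_n}$, and let $\mathrm{wt}(E_\alpha)$ be the number of $i$ with $e_{\alpha_i}\ne I_d$. Let $\mathcal Q\subseteq(\mathbb{C}^d)^{\otimes n}$ be an $((n,K,\delta))_d$ quantum error-correcting code, i.e. a subspace of dimension $K\ge 1$ such that for every $E_\alpha$ with $\mathrm{wt}(E_\alpha)<\delta$ the value $\langle\psi|E_\alpha|\psi\rangle$ is the same for all unit vectors $|\psi\rangle\in\mathcal Q$ (and equals $\mathrm{Tr}(E_\alpha)/d^n$ if $K=1$). Let $\rho=\rho_{\mathcal Q}=\Pi_{\mathcal Q}/K$ be its normalized projector, $\rho_T$ the reduced state of $\rho$ on $T\subseteq[n]$, $T^c=[n]\setminus T$, and for $0\le j\le n$ define the Shor-Laflamme and Rains unitary enumerators $$A_j=\sum_{\mathrm{wt}(E_\alpha)=j}\mathrm{Tr}(E_\alpha\rho)\,\mathrm{Tr}(E_\alpha^\dagger\rho),\qquad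 B_j=\sum_{\mathrm{wt}(E_\alpha)=j}\mathrm{Tr}(E_\alpha\rho E_\alpha^\dagger\rho),$$ $$A'_j=\sum_{|T|=j}\mathrm{Tr}(\rho_T^2),\qquad B'_j=\sum_{|T|=j}\mathrm{Tr}(\rho_{T^c}^2).$$ For $\mathbf z\in\mathbb{Z}_2^n$ let $p(\mathbf z)$ be the probability of measuring $\mathbf z$ on the ancillas in the $n$-qubit parallelized SWAP test of $\rho$ and $\rho$: $n$ ancilla qubits are prepared in $|0\rangle^{\otimes n}$ next to two copies $\rho\otimes\rho$; a Hadamard gate is applied to every ancilla, then for every $i$ a SWAP of the $i$-th subsystems of the two copies controlled by the $i$-th ancilla, then again a Hadamard gate to every ancilla; finally the ancillas are measured in the computational basis. Write $\mathrm{wt}(\mathbf t)=|\{i: t_i\neq 0\}|$ and $\mathbf z\cdot\mathbf t=\sum_i z_it_i$ for $\mathbf z,\mathbf t\in\mathbb{Z}_2^n$. Then for all $0\le j\le n$ $$A_j=\sum_{k=0}^j(-1)^{j-k}\binom{n-k}{j-k}d^k\sum_{\mathrm{wt}(\mathbf t)=k}\ \sum_{\mathbf z\in\mathbb{Z}_2^n}(-1)^{\mathbf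 z\cdot\mathbf t}p(\mathbf z),$$ $$B_j=\sum_{k=0}^j(-1)^{j-k}\binom{n-k}{j-k}d^k\sum_{\mathrm{wt}(\mathbf t)=n-k}\ \sum_{\mathbf z\in\mathbb{Z}_2^n}(-1)^{\mathbf z\cdot\mathbf t}p(\mathbf z),$$ $$A'_j=\sum_{\mathrm{wt}(\mathbf t)=j}\ \sum_{\mathbf z\in\mathbb{Z}_2^n}(-1)^{\mathbf z\cdot\mathbf t}p(\mathbf z),\qquad B'_j=\sum_{\mathrm{wt}(\mathbf t)=n-j}\ \sum_{\mathbf z\in\mathbb{Z}_2^n}(-1)^{\mathbf z\cdot\mathbf t}p(\mathbf z).$$ -/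

import Mathlib

open scoped Matrix Kronecker

namespace SwapTest

noncomputable section

/-- The Hilbert space `(ℂ^d)^{⊗ n}`, in the computational basis indexed by words of length `n`. -/
abbrev Hilb (n d : ℕ) : Type := EuclideanSpace ℂ (Fin n → Fin d)

/-- Operators on `(ℂ^d)^{⊗ n}`, as matrices in the computational basis. -/
abbrev Op (n d : ℕ) : Type := Matrix (Fin n → Fin d) (Fin n → Fin d) ℂ

/-- The tensor product `M₁ ⊗ ⋯ ⊗ Mₙ` of matrices on the single tensor factors. -/
def tensorMatrix {n : ℕ} {κ : Type} (M : Fin n → Matrix κ κ ℂ) :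
    Matrix (Fin n → κ) (Fin n → κ) ℂ :=
  Matrix.of fun x y => ∏ i, M i (x i) (y i)

/-! ### Error bases and codes -/

/-- `e` is an orthogonal basis of the `d × d` matrices with `Tr(e_j† e_k) = d δ_{jk}`, one of whose
members is the identity. -/
structure IsErrorBasis {d : ℕ} (e : Fin (d ^ 2) → Matrix (Fin d) (Fin d) ℂ) : Prop where
  orthogonal : ∀ j k, ((e j)ᴴ * e k).trace = if j = k then (d : ℂ) else 0
  one_mem : ∃ j, e j = 1

/-- The error `E_α = e_{α₁} ⊗ ⋯ ⊗ e_{αₙ}`. -/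
def errorOp {n d : ℕ} (e : Fin (d ^ 2) → Matrix (Fin d) (Fin d) ℂ) (α : Fin n → Fin (d ^ 2)) :
    Op n d :=
  tensorMatrix fun i => e (α i)

open Classical in
/-- The weight of `E_α`: the number of factors different from the identity. -/
def errorWt {n d : ℕ} (e : Fin (d ^ 2) → Matrix (Fin d) (Fin d) ℂ) (α : Fin n → Fin (d ^ 2)) : ℕ :=
  (Finset.univ.filter fun i => e (α i) ≠ 1).card

/-- `⟨ψ| E |ψ⟩`. -/
def expectation {n d : ℕ} (E : Op n d) (ψ : Hilb n d) : ℂ :=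
  star (ψ : (Fin n → Fin d) → ℂ) ⬝ᵥ (E *ᵥ (ψ : (Fin n → Fin d) → ℂ))

/-- `Q` is an `((n, K, δ))_d` quantum error-correcting code. By the usual convention,
one-dimensional codes are required to be pure. -/
structure IsQECC {n d : ℕ} (e : Fin (d ^ 2) → Matrix (Fin d) (Fin d) ℂ)
    (Q : Submodule ℂ (Hilb n d)) (K δ : ℕ) : Prop where
  finrank_eq : Module.finrank ℂ Q = K
  detects : ∃ C : Op n d → ℂ, ∀ α : Fin n → Fin (d ^ 2), errorWt e α < δ →
    ∀ ψ ∈ Q, ‖ψ‖ = 1 → expectation (errorOp e α) ψ = C (errorOp e α)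
  pure_of_one : K = 1 → ∀ α : Fin n → Fin (d ^ 2), errorWt e α < δ →
    ∀ ψ ∈ Q, ‖ψ‖ = 1 → expectation (errorOp e α) ψ = (errorOp e α).trace / (d : ℂ) ^ n

/-- The matrix `Π_Q` of the orthogonal projector onto `Q`. -/
def projector {n d : ℕ} (Q : Submodule ℂ (Hilb n d)) : Op n d :=
  LinearMap.toMatrix (EuclideanSpace.basisFun (Fin n → Fin d) ℂ).toBasis
    (EuclideanSpace.basisFun (Fin n → Fin d) ℂ).toBasis (Q.starProjection : Hilb n d →ₗ[ℂ] Hilb n d)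

/-- The normalized projector `ρ_Q = Π_Q / dim Q`. -/
def codeState {n d : ℕ} (Q : Submodule ℂ (Hilb n d)) : Op n d :=
  ((Module.finrank ℂ Q : ℂ))⁻¹ • projector Q

/-! ### Weight enumerators -/

/-- The reduced operator `ρ_S = Tr_{Sᶜ} ρ` (partial trace over the factors outside `S`). -/
def reduced {n d : ℕ} (ρ : Op n d) (S : Finset (Fin n)) :
    Matrix ({i // i ∈ S} → Fin d) ({i // i ∈ S} → Fin d) ℂ :=
  Matrix.of fun a b => ∑ c : {i // i ∉ S} → Fin d,
    ρ ((Equiv.piEquivPiSubtypeProd (fun i => i ∈ S) fun _ => Fin d).symm (a, c))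
      ((Equiv.piEquivPiSubtypeProd (fun i => i ∈ S) fun _ => Fin d).symm (b, c))

/-- The Shor-Laflamme enumerator `A_j` of `ρ`. -/
def shorLaflammeA {n d : ℕ} (e : Fin (d ^ 2) → Matrix (Fin d) (Fin d) ℂ) (ρ : Op n d) (j : ℕ) : ℂ :=
  ∑ α : Fin n → Fin (d ^ 2) with errorWt e α = j,
    (errorOp e α * ρ).trace * ((errorOp e α)ᴴ * ρ).trace

/-- The Shor-Laflamme enumerator `B_j` of `ρ`. -/
def shorLaflammeB {n d : ℕ} (e : Fin (d ^ 2) → Matrix (Fin d) (Fin d) ℂ) (ρ : Op n d) (j : ℕ) : ℂ :=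
  ∑ α : Fin n → Fin (d ^ 2) with errorWt e α = j,
    (errorOp e α * ρ * (errorOp e α)ᴴ * ρ).trace

/-- The Rains unitary enumerator `A'_j` of `ρ`. -/
def rainsA {n d : ℕ} (ρ : Op n d) (j : ℕ) : ℂ :=
  ∑ T : Finset (Fin n) with T.card = j, (reduced ρ T ^ 2).trace

/-- The Rains unitary enumerator `B'_j` of `ρ`. -/
def rainsB {n d : ℕ} (ρ : Op n d) (j : ℕ) : ℂ :=
  ∑ T : Finset (Fin n) with T.card = j, (reduced ρ Tᶜ ^ 2).trace

/-! ### The parallelized SWAP test -/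

/-- Bitstrings of length `n`. -/
abbrev Bits (n : ℕ) : Type := Fin n → ZMod 2

/-- The weight of a bitstring. -/
def bitWt {n : ℕ} (z : Bits n) : ℕ := (Finset.univ.filter fun i => z i ≠ 0).card

/-- The inner product `u · v = ∑ uᵢ vᵢ` of bitstrings, as a natural number. -/
def bitDot {n : ℕ} (u v : Bits n) : ℕ := ∑ i, (u i).val * (v i).val

/-- The Hadamard gate on one qubit. -/
def hadamard : Matrix (ZMod 2) (ZMod 2) ℂ :=
  Matrix.of fun a b => ((Real.sqrt 2 : ℝ) : ℂ)⁻¹ * (-1) ^ (a.val * b.val)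

/-- The controlled-SWAP gate on a control qubit and two systems of dimension `d`: it maps
`|0⟩|u⟩|v⟩` to `|0⟩|u⟩|v⟩` and `|1⟩|u⟩|v⟩` to `|1⟩|v⟩|u⟩`. -/
def cswap (d : ℕ) : Matrix (ZMod 2 × Fin d × Fin d) (ZMod 2 × Fin d × Fin d) ℂ :=
  Matrix.of fun p q => if p = (if q.1 = 1 then (q.1, q.2.2, q.2.1) else q) then 1 else 0

/-- Basis labels of the circuit: the ancilla qubits `A₁ … Aₙ`, and the two registers `B₁ … Bₙ`,
`C₁ … Cₙ` that hold the two input states. -/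
abbrev Reg (n d : ℕ) : Type := Bits n × (Fin n → Fin d) × (Fin n → Fin d)

/-- A Hadamard gate on every ancilla. -/
def hadamardLayer (n d : ℕ) : Matrix (Reg n d) (Reg n d) ℂ :=
  tensorMatrix (fun _ : Fin n => hadamard) ⊗ₖ
    (1 : Matrix ((Fin n → Fin d) × (Fin n → Fin d)) ((Fin n → Fin d) × (Fin n → Fin d)) ℂ)

/-- A controlled-SWAP gate on `Aᵢ, Bᵢ, Cᵢ` for every `i`. -/
def cswapLayer (n d : ℕ) : Matrix (Reg n d) (Reg n d) ℂ :=
  Matrix.of fun p q =>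
    ∏ i, cswap d (p.1 i, p.2.1 i, p.2.2 i) (q.1 i, q.2.1 i, q.2.2 i)

/-- The unitary of the `n`-qubit parallelized SWAP test. -/
def circuit (n d : ℕ) : Matrix (Reg n d) (Reg n d) ℂ :=
  hadamardLayer n d * cswapLayer n d * hadamardLayer n d

/-- The state `U (|0⋯0⟩⟨0⋯0| ⊗ ρ ⊗ σ) U†` at the end of the circuit. -/
def outputState {n d : ℕ} (ρ σ : Op n d) : Matrix (Reg n d) (Reg n d) ℂ :=
  circuit n d * (Matrix.single (0 : Bits n) (0 : Bits n) (1 : ℂ) ⊗ₖ (ρ ⊗ₖ σ)) * (circuit n d)ᴴ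

/-- The probability `p(z) = Tr[(|z⟩⟨z| ⊗ 1) ρ_out]` of reading `z` on the ancillas. -/
def prob {n d : ℕ} (ρ σ : Op n d) (z : Bits n) : ℝ :=
  (((Matrix.single z z (1 : ℂ) ⊗ₖ
    (1 : Matrix ((Fin n → Fin d) × (Fin n → Fin d)) ((Fin n → Fin d) × (Fin n → Fin d)) ℂ)) *
      outputState ρ σ).trace).re

end

end SwapTest

open scoped Matrix Kronecker

/-! Everything reduces to the numbers `Tr[(ρ ⊗ ρ) SWAP_T]`, `swapTrace ρ ρ T`, for `T ⊆ [n]`. On the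
circuit side, the local swaps represent `ℤ₂ⁿ`, and the circuit applies a signed average of them.
Hence `p(z)` is `2⁻ⁿ` times the Walsh-Hadamard transform of `t ↦ Tr[(ρ ⊗ ρ) SWAP_{supp t}]`
(`trace_outputState`), and orthogonality of characters inverts this (`sum_neg_one_pow_mul_prob`). On
the enumerator side, the swap trick turns the purity of `ρ_T` into such a trace
(`trace_reduced_sq`), which settles `A'` and `B'`. For `A` and `B`, completeness of the error basis
evaluates the sum over all errors supported in `T` as `d ^ |T|` times the swap trace at `T`,
respectively `Tᶜ`. Möbius inversion on the subset lattice (`sum_filter_card_eq`) then passes from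
"supported in `T`" to "of weight `j`", producing the signs and binomials. -/

namespace SwapTest

/-! ### Local swaps and the swap trick. -/

section Swap

variable {n : ℕ} {κ : Type}

/-- Exchange of the two words of a pair at the positions in `T`. -/
def swapAt (T : Finset (Fin n)) (p : (Fin n → κ) × (Fin n → κ)) : (Fin n → κ) × (Fin n → κ) :=
  (T.piecewise p.2 p.1, T.piecewise p.1 p.2)

theorem swapAt_swapAt (S T : Finset (Fin n)) (p : (Fin n → κ) × (Fin n → κ)) :
    swapAt S (swapAt T p) = swapAt (symmDiff S T) p := by
  ext i <;> by_cases hS : i ∈ S <;> by_cases hT : i ∈ T <;>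
    simp [swapAt, Finset.piecewise, Finset.mem_symmDiff, hS, hT]

theorem swapAt_self (T : Finset (Fin n)) (p : (Fin n → κ) × (Fin n → κ)) :
    swapAt T (swapAt T p) = p := by
  rw [swapAt_swapAt, symmDiff_self]; simp [swapAt]

/-- `Tr[(ρ ⊗ σ) SWAP_T]`. -/
noncomputable def swapTrace {d : ℕ} (ρ σ : Op n d) (T : Finset (Fin n)) : ℂ :=
  ∑ p, (ρ ⊗ₖ σ) p (swapAt T p)

/-- The swap trick: splitting each word into its parts inside and outside `T`, both sides are the
same sum of products of two entries of `ρ`, with the inner parts crossed over and the outer parts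
traced. -/
theorem trace_reduced_sq {d : ℕ} (ρ : Op n d) (T : Finset (Fin n)) :
    (reduced ρ T ^ 2).trace = swapTrace ρ ρ T := by
  set φ := (Equiv.piEquivPiSubtypeProd (fun i => i ∈ T) fun _ => Fin d).symm with hφ
  have hpw : ∀ a b c c', T.piecewise (φ (a, c)) (φ (b, c')) = φ (a, c') := by
    intro a b c c'
    ext i
    by_cases hi : i ∈ T <;> simp [hφ, hi, Equiv.piEquivPiSubtypeProd]
  calc (reduced ρ T ^ 2).trace
      = ∑ a, ∑ b, ∑ c, ∑ c', ρ (φ (a, c)) (φ (b, c)) * ρ (φ (b, c')) (φ (a, c')) := by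
        simp only [pow_two, Matrix.trace, Matrix.diag, Matrix.mul_apply, reduced, Matrix.of_apply,
          Finset.sum_mul_sum, hφ]
    _ = ∑ a, ∑ c, ∑ b, ∑ c', ρ (φ (a, c)) (φ (b, c)) * ρ (φ (b, c')) (φ (a, c')) :=
        Finset.sum_congr rfl fun a _ => Finset.sum_comm
    _ = swapTrace ρ ρ T := by
        rw [swapTrace, Fintype.sum_prod_type, ← φ.sum_comp, Fintype.sum_prod_type]
        refine Finset.sum_congr rfl fun a _ => Finset.sum_congr rfl fun c _ => ?_
        rw [← φ.sum_comp, Fintype.sum_prod_type]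
        simp [swapAt, hpw]

end Swap

/-! ### Bitstrings as subsets, and the characters of `ℤ₂ⁿ`. -/

section Bits

variable {n : ℕ}

/-- The support of a bitstring. -/
def supp (t : Bits n) : Finset (Fin n) := Finset.univ.filter fun i => t i ≠ 0

theorem mem_supp {t : Bits n} {i : Fin n} : i ∈ supp t ↔ t i = 1 := by
  have h : ∀ a : ZMod 2, a ≠ 0 ↔ a = 1 := by decide
  simp [supp, h]

theorem supp_add (s t : Bits n) : supp (s + t) = symmDiff (supp s) (supp t) := by
  have h : ∀ a b : ZMod 2, a + b = 1 ↔ (a = 1 ∧ ¬ b = 1) ∨ (b = 1 ∧ ¬ a = 1) := by decide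
  ext i
  simp only [Finset.mem_symmDiff, mem_supp, Pi.add_apply, h]

/-- Bitstrings are the same thing as subsets of the positions. -/
def bitsEquiv (n : ℕ) : Bits n ≃ Finset (Fin n) where
  toFun := supp
  invFun T i := if i ∈ T then 1 else 0
  left_inv t := by
    have h : ∀ a : ZMod 2, (if a = 1 then (1 : ZMod 2) else 0) = a := by decide
    ext i
    simp only [mem_supp, h]
  right_inv T := by
    ext i
    simp [mem_supp]

theorem sum_bitWt_eq (f : Finset (Fin n) → ℂ) (k : ℕ) :
    ∑ t : Bits n with bitWt t = k, f (supp t) = ∑ T : Finset (Fin n) with T.card = k, f T := by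
  rw [Finset.sum_filter, Finset.sum_filter]
  exact (bitsEquiv n).sum_comp fun T : Finset (Fin n) => if T.card = k then f T else 0

/-- The bound on `k` matters: for `k > n` the left side is empty, while truncated subtraction leaves
the term `f ∅` on the right. -/
theorem sum_compl_card (f : Finset (Fin n) → ℂ) {k : ℕ} (hk : k ≤ n) :
    ∑ T : Finset (Fin n) with T.card = k, f Tᶜ =
      ∑ T : Finset (Fin n) with T.card = n - k, f T := by
  refine Finset.sum_nbij' compl compl ?_ ?_ ?_ ?_ ?_ <;>
    simp [Finset.card_compl] <;> omega

/-- The character `(-1)^{z · t}`. -/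
noncomputable def bitSign (z t : Bits n) : ℂ := (-1) ^ bitDot z t

theorem bitSign_eq_prod (z t : Bits n) : bitSign z t = ∏ i, (-1 : ℂ) ^ ((z i).val * (t i).val) :=
  (Finset.prod_pow_eq_pow_sum _ _ _).symm

theorem neg_one_pow_val_mul_add (a b c : ZMod 2) :
    (-1 : ℂ) ^ (a.val * (b + c).val) = (-1) ^ (a.val * b.val) * (-1) ^ (a.val * c.val) := by
  -- `val` is additive only modulo 2, which is all that the sign sees.
  have h : ∀ a b c : ZMod 2, (a.val * (b + c).val) % 2 = (a.val * b.val + a.val * c.val) % 2 := by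
    decide
  rw [← pow_add, neg_one_pow_eq_pow_mod_two, h, ← neg_one_pow_eq_pow_mod_two]

theorem bitSign_add (z s t : Bits n) : bitSign z (s + t) = bitSign z s * bitSign z t := by
  simp only [bitSign_eq_prod, Pi.add_apply, neg_one_pow_val_mul_add, Finset.prod_mul_distrib]

theorem star_bitSign (z t : Bits n) : star (bitSign z t) = bitSign z t := by
  simp [bitSign]

theorem sum_neg_one_pow_val_mul (a : ZMod 2) :
    ∑ b : ZMod 2, (-1 : ℂ) ^ (b.val * a.val) = if a = 0 then 2 else 0 := by
  -- Over `ℤ` the identity is decidable; it is then cast to `ℂ`.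
  have h : (∑ b : ZMod 2, (-1 : ℤ) ^ (b.val * a.val)) = if a = 0 then 2 else 0 := by
    revert a; decide
  have := congrArg (Int.cast : ℤ → ℂ) h
  push_cast at this
  exact this

theorem sum_bitSign (t : Bits n) : ∑ z, bitSign z t = if t = 0 then 2 ^ n else 0 := by
  simp only [bitSign_eq_prod]
  rw [← Fintype.prod_sum fun i (b : ZMod 2) => (-1 : ℂ) ^ (b.val * (t i).val)]
  simp only [sum_neg_one_pow_val_mul]
  rw [Finset.prod_ite_zero]
  simp [funext_iff]

end Bits

/-! ### Outcome distribution of the circuit. -/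

section Circuit

variable {n d : ℕ}

theorem cswapLayer_apply (s s' : Bits n) (u v : (Fin n → Fin d) × (Fin n → Fin d)) :
    cswapLayer n d (s, u) (s', v) = if s = s' ∧ u = swapAt (supp s') v then 1 else 0 := by
  simp only [cswapLayer, cswap, Matrix.of_apply]
  rw [Finset.prod_ite_zero]
  simp only [Finset.prod_const_one, Finset.mem_univ, true_imp_iff]
  refine if_congr ?_ rfl rfl
  simp only [Prod.ext_iff, funext_iff, swapAt, ← forall_and]
  refine forall_congr' fun i => ?_
  by_cases h : s' i = 1 <;> simp [Finset.piecewise, mem_supp, h]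

theorem hadamardLayer_apply (s s' : Bits n) (u v : (Fin n → Fin d) × (Fin n → Fin d)) :
    hadamardLayer n d (s, u) (s', v) =
      if u = v then (((Real.sqrt 2 : ℝ) : ℂ)⁻¹) ^ n * bitSign s s' else 0 := by
  simp [hadamardLayer, tensorMatrix, hadamard, Matrix.one_apply, Finset.prod_mul_distrib,
    bitSign_eq_prod]

/-- Only the columns with ancillas in `0` meet the input state. There the first Hadamard layer gives
a uniform superposition of control words `s`, and the second attaches the sign `(-1)^{z · s}`; each
contributes `√2⁻ⁿ`. -/
theorem circuit_apply_zero (z : Bits n) (u v : (Fin n → Fin d) × (Fin n → Fin d)) :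
    circuit n d (z, u) (0, v) =
      (2 ^ n)⁻¹ * ∑ s, bitSign z s * if v = swapAt (supp s) u then 1 else 0 := by
  have h0 : ∀ s : Bits n, bitSign s 0 = 1 := fun s => by simp [bitSign, bitDot]
  have h2 : (((Real.sqrt 2 : ℝ) : ℂ)⁻¹) ^ n * (((Real.sqrt 2 : ℝ) : ℂ)⁻¹) ^ n = (2 ^ n)⁻¹ := by
    rw [← mul_pow, ← mul_inv, ← Complex.ofReal_mul, Real.mul_self_sqrt (by norm_num), inv_pow]
    norm_num
  have hsw : ∀ s : Bits n, u = swapAt (supp s) v ↔ v = swapAt (supp s) u := fun s =>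
    ⟨fun h => by rw [h, swapAt_self], fun h => by rw [h, swapAt_self]⟩
  rw [circuit, Matrix.mul_apply, Fintype.sum_prod_type, Finset.mul_sum]
  refine Finset.sum_congr rfl fun s _ => ?_
  simp only [hadamardLayer_apply, h0, mul_ite, mul_zero, Finset.sum_ite_eq', Finset.mem_univ,
    if_true, mul_one]
  rw [Matrix.mul_apply, Fintype.sum_prod_type]
  simp only [hadamardLayer_apply, cswapLayer_apply, ite_mul, zero_mul, Finset.sum_ite_eq,
    Finset.mem_univ, if_true]
  simp only [ite_and, mul_ite, mul_one, mul_zero, Finset.sum_ite_eq', Finset.mem_univ,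
    if_true, hsw]
  rw [← h2]
  split_ifs <;> ring

theorem outputState_apply (ρ σ : Op n d) (z : Bits n) (u : (Fin n → Fin d) × (Fin n → Fin d)) :
    outputState ρ σ (z, u) (z, u) =
      ∑ w, ∑ v, circuit n d (z, u) (0, v) * (ρ ⊗ₖ σ) v w * star (circuit n d (z, u) (0, w)) := by
  rw [outputState, Matrix.mul_apply, Fintype.sum_prod_type, Finset.sum_eq_single 0]
  · refine Finset.sum_congr rfl fun w _ => ?_
    rw [Matrix.mul_apply, Fintype.sum_prod_type, Finset.sum_eq_single 0, Finset.sum_mul]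
    · refine Finset.sum_congr rfl fun v _ => ?_
      rw [Matrix.conjTranspose_apply, Matrix.kroneckerMap_apply (f := (· * ·)),
        Matrix.single_apply_same, one_mul]
    · intro s _ hs
      refine Finset.sum_eq_zero fun v _ => ?_
      rw [Matrix.kroneckerMap_apply (f := (· * ·)), Matrix.single_apply_of_row_ne (Ne.symm hs),
        zero_mul, mul_zero]
    · simp
  · intro s _ hs
    refine Finset.sum_eq_zero fun w _ => ?_
    rw [Matrix.mul_apply, Finset.sum_eq_zero, zero_mul]
    rintro ⟨s', v⟩ _
    rw [Matrix.kroneckerMap_apply (f := (· * ·)), Matrix.single_apply_of_col_ne _ _ (Ne.symm hs),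
      zero_mul, mul_zero]
  · simp

/-- The two circuit factors give a double sum over control words `s`, `t`. Since swaps compose by
symmetric difference, its terms depend only on `r = s + t`; each `r` occurs `2 ^ n` times,
cancelling one of the two factors `2⁻ⁿ`. -/
theorem trace_outputState (ρ σ : Op n d) (z : Bits n) :
    ∑ u, outputState ρ σ (z, u) (z, u) =
      (2 ^ n)⁻¹ * ∑ r, bitSign z r * swapTrace ρ σ (supp r) := by
  have key : ∀ s t : Bits n, ∑ u, (ρ ⊗ₖ σ) (swapAt (supp s) u) (swapAt (supp t) u) =
      swapTrace ρ σ (supp (s + t)) := by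
    intro s t
    rw [swapTrace]
    refine Fintype.sum_bijective (swapAt (supp s))
      (Function.Involutive.bijective (swapAt_self _)) _ _ fun u => ?_
    rw [swapAt_swapAt, supp_add, symmDiff_comm (supp s), symmDiff_symmDiff_cancel_right]
  have hpt : ∀ u, outputState ρ σ (z, u) (z, u) = (2 ^ n)⁻¹ * (2 ^ n)⁻¹ * ∑ s, ∑ t,
      bitSign z (s + t) * (ρ ⊗ₖ σ) (swapAt (supp s) u) (swapAt (supp t) u) := by
    intro u
    rw [outputState_apply]
    simp only [circuit_apply_zero, star_mul', star_sum, star_bitSign]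
    calc _ = ∑ w, ∑ v, ∑ s, ∑ t, (2 ^ n)⁻¹ * (2 ^ n)⁻¹ * (bitSign z (s + t) *
          if w = swapAt (supp t) u then if v = swapAt (supp s) u then (ρ ⊗ₖ σ) v w else 0
            else 0) := by
          refine Finset.sum_congr rfl fun w _ => Finset.sum_congr rfl fun v _ => ?_
          rw [mul_right_comm, mul_mul_mul_comm, Finset.sum_mul_sum, Finset.mul_sum, Finset.sum_mul]
          refine Finset.sum_congr rfl fun s _ => ?_
          rw [Finset.mul_sum, Finset.sum_mul]
          refine Finset.sum_congr rfl fun t _ => ?_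
          rw [bitSign_add]
          split_ifs <;> simp
          ring
      _ = ∑ s, ∑ t, ∑ w, ∑ v, (2 ^ n)⁻¹ * (2 ^ n)⁻¹ * (bitSign z (s + t) *
          if w = swapAt (supp t) u then if v = swapAt (supp s) u then (ρ ⊗ₖ σ) v w else 0
            else 0) := by
          rw [Finset.sum_congr rfl fun w _ => Finset.sum_comm, Finset.sum_comm]
          refine Finset.sum_congr rfl fun s _ => ?_
          rw [Finset.sum_congr rfl fun w _ => Finset.sum_comm, Finset.sum_comm]
      _ = _ := by
          simp only [← Finset.mul_sum]
          simp
  simp only [hpt]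
  rw [← Finset.mul_sum, mul_assoc]
  congr 1
  rw [Finset.sum_comm]
  calc _ = (2 ^ n : ℂ)⁻¹ * ∑ s : Bits n, ∑ t : Bits n, bitSign z (s + t) *
        swapTrace ρ σ (supp (s + t)) := by
        congr 1
        refine Finset.sum_congr rfl fun s _ => ?_
        rw [Finset.sum_comm]
        simp only [← Finset.mul_sum, key]
    _ = (2 ^ n : ℂ)⁻¹ * ∑ s : Bits n, ∑ r : Bits n, bitSign z r * swapTrace ρ σ (supp r) := by
        congr 1
        exact Finset.sum_congr rfl fun s _ => Equiv.sum_comp (Equiv.addLeft s)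
          fun r : Bits n => bitSign z r * swapTrace ρ σ (supp r)
    _ = _ := by
        simp [ZMod.card]

/-- `prob` is defined as a real part; Hermiticity of the output state makes its diagonal real, so
nothing is lost. -/
theorem ofReal_prob {ρ σ : Op n d} (hρ : ρ.IsHermitian) (hσ : σ.IsHermitian) (z : Bits n) :
    (prob ρ σ z : ℂ) = ∑ u, outputState ρ σ (z, u) (z, u) := by
  have hher : (outputState ρ σ).IsHermitian := by
    refine Matrix.isHermitian_mul_mul_conjTranspose _ ?_
    rw [Matrix.IsHermitian, Matrix.conjTranspose_kronecker, Matrix.conjTranspose_kronecker, hρ.eq,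
      hσ.eq, Matrix.conjTranspose_single, star_one]
  have htr : ((Matrix.single z z (1 : ℂ) ⊗ₖ
      (1 : Matrix ((Fin n → Fin d) × (Fin n → Fin d)) ((Fin n → Fin d) × (Fin n → Fin d)) ℂ)) *
        outputState ρ σ).trace = ∑ u, outputState ρ σ (z, u) (z, u) := by
    rw [Matrix.trace, Fintype.sum_prod_type, Finset.sum_eq_single z]
    · refine Finset.sum_congr rfl fun u _ => ?_
      rw [Matrix.diag_apply, Matrix.mul_apply, Finset.sum_eq_single (z, u)]
      · simp
      · rintro ⟨s, v⟩ _ h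
        by_cases hs : z = s
        · have : u ≠ v := fun huv => h (by rw [hs, huv])
          simp [this]
        · simp [hs]
      · simp
    · intro s _ hs
      refine Finset.sum_eq_zero fun u _ => ?_
      rw [Matrix.diag_apply, Matrix.mul_apply]
      refine Finset.sum_eq_zero fun p _ => ?_
      simp [Matrix.single_apply_of_row_ne (Ne.symm hs)]
    · simp
  rw [prob, htr, Complex.re_sum, Complex.ofReal_sum]
  exact Finset.sum_congr rfl fun u _ => hher.coe_re_apply_self _

/-- The Walsh-Hadamard transform of the outcome distribution of the parallelized SWAP test
consists of the traces `Tr[(ρ ⊗ σ) SWAP_T]`. -/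
theorem sum_neg_one_pow_mul_prob {ρ σ : Op n d} (hρ : ρ.IsHermitian) (hσ : σ.IsHermitian)
    (t : Bits n) :
    ∑ z : Bits n, (-1 : ℂ) ^ bitDot z t * (prob ρ σ z : ℂ) = swapTrace ρ σ (supp t) := by
  have hadd : ∀ r : Bits n, t + r = 0 ↔ r = t := by
    have h : ∀ a b : ZMod 2, a + b = 0 ↔ b = a := by decide
    intro r
    simp only [funext_iff, Pi.add_apply, Pi.zero_apply, h]
  -- The two signs merge into the character at `t + r`, whose sum over `z` vanishes unless `r = t`.
  calc _ = ∑ z : Bits n, ∑ r : Bits n,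
        bitSign z (t + r) * ((2 ^ n)⁻¹ * swapTrace ρ σ (supp r)) := by
        refine Finset.sum_congr rfl fun z _ => ?_
        rw [ofReal_prob hρ hσ, trace_outputState, ← bitSign, Finset.mul_sum, Finset.mul_sum]
        refine Finset.sum_congr rfl fun r _ => ?_
        rw [bitSign_add]
        ring
    _ = _ := by
        rw [Finset.sum_comm]
        simp only [← Finset.sum_mul, sum_bitSign, hadd]
        simp

end Circuit

/-! ### Hermiticity of the code state. -/

section Code

variable {n d : ℕ}

theorem isHermitian_projector (Q : Submodule ℂ (Hilb n d)) : (projector Q).IsHermitian := by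
  ext x y
  have happ : ∀ x y, projector Q x y = inner ℂ (EuclideanSpace.basisFun (Fin n → Fin d) ℂ x)
      (Q.starProjection (EuclideanSpace.basisFun (Fin n → Fin d) ℂ y)) := by
    intro x y
    rw [projector, LinearMap.toMatrix_apply]
    simp [EuclideanSpace.inner_single_left]
  rw [Matrix.conjTranspose_apply, happ, happ, ← starRingEnd_apply, inner_conj_symm,
    Q.inner_starProjection_left_eq_right]

theorem isHermitian_codeState (Q : Submodule ℂ (Hilb n d)) : (codeState Q).IsHermitian := by
  rw [codeState, Matrix.IsHermitian, Matrix.conjTranspose_smul, (isHermitian_projector Q).eq]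
  simp

end Code

/-! ### Möbius inversion over subsets. -/

section Inversion

variable {n : ℕ}

/-- For `S ⊆ R`, both sides are the product over `i ∈ R` of `1 - [i ∉ S]`: evaluated factor by
factor it is `[S = R]`, and expanded over the subsets `T` of `R` it is the alternating sum. -/
theorem sum_powerset_neg_one_pow_ite {S R : Finset (Fin n)} :
    ∑ T ∈ R.powerset, (-1 : ℂ) ^ (R.card - T.card) * (if S ⊆ T then 1 else 0) =
      if S = R then 1 else 0 := by
  by_cases hSR : S ⊆ R
  · have h := Finset.prod_add (fun _ => (1 : ℂ)) (fun i => if i ∈ S then 0 else -1) R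
    have hl : ∏ i ∈ R, ((1 : ℂ) + if i ∈ S then 0 else -1) = if S = R then 1 else 0 := by
      have : ∀ i, ((1 : ℂ) + if i ∈ S then 0 else -1) = if i ∈ S then 1 else 0 := by
        intro i; split_ifs <;> simp
      simp only [this, Finset.prod_ite_zero, Finset.prod_const_one]
      exact if_congr ⟨fun h => hSR.antisymm h, fun h => h.ge⟩ rfl rfl
    rw [← hl, h]
    refine Finset.sum_congr rfl fun T hT => ?_
    have hT := Finset.mem_powerset.1 hT
    have : ∀ i, (if i ∈ S then (0 : ℂ) else -1) = if i ∉ S then -1 else 0 := by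
      intro i; split_ifs <;> simp_all
    simp only [this, Finset.prod_ite_zero, Finset.prod_const, Finset.card_sdiff_of_subset hT,
      one_pow, one_mul, mul_ite, mul_one, mul_zero]
    refine if_congr ⟨fun h i hi hiS => (Finset.mem_sdiff.1 hi).2 (h hiS), fun h i hi => ?_⟩ rfl rfl
    by_contra hiT
    exact h i (Finset.mem_sdiff.2 ⟨hSR hi, hiT⟩) hi
  · rw [if_neg fun h => hSR h.le]
    refine Finset.sum_eq_zero fun T hT => ?_
    rw [if_neg fun h => hSR (h.trans (Finset.mem_powerset.1 hT)), mul_zero]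

/-- Source of the binomial coefficient: `R ↦ R \ T` is a bijection onto the subsets of `Tᶜ` of size
`j - |T|`. -/
theorem card_filter_superset (T : Finset (Fin n)) {j : ℕ} (hj : T.card ≤ j) :
    (Finset.univ.filter fun R : Finset (Fin n) => R.card = j ∧ T ⊆ R).card =
      (n - T.card).choose (j - T.card) := by
  have h : (Tᶜ.powersetCard (j - T.card)).card = (n - T.card).choose (j - T.card) := by
    rw [Finset.card_powersetCard, Finset.card_compl, Fintype.card_fin]
  rw [← h]
  refine Finset.card_nbij' (fun R => R \ T) (fun P => P ∪ T) ?_ ?_ ?_ ?_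
  · intro R hR
    simp only [Finset.coe_filter, Finset.mem_univ, true_and, Set.mem_ofPred_eq] at hR
    rw [Finset.mem_coe, Finset.mem_powersetCard]
    refine ⟨fun i hi => ?_, by rw [Finset.card_sdiff_of_subset hR.2, hR.1]⟩
    exact Finset.mem_compl.2 (Finset.mem_sdiff.1 hi).2
  · intro P hP
    rw [Finset.mem_coe, Finset.mem_powersetCard] at hP
    simp only [Finset.coe_filter, Finset.mem_univ, true_and, Set.mem_ofPred_eq]
    have hd : Disjoint P T := Finset.disjoint_left.2 fun i hi => Finset.mem_compl.1 (hP.1 hi)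
    exact ⟨by rw [Finset.card_union_of_disjoint hd, hP.2]; omega, Finset.subset_union_right⟩
  · intro R hR
    simp only [Finset.coe_filter, Finset.mem_univ, true_and, Set.mem_ofPred_eq] at hR
    exact Finset.sdiff_union_of_subset hR.2
  · intro P hP
    rw [Finset.mem_coe, Finset.mem_powersetCard] at hP
    have hd : Disjoint P T := Finset.disjoint_left.2 fun i hi => Finset.mem_compl.1 (hP.1 hi)
    exact Finset.union_sdiff_cancel_right hd

/-- Inversion of the relation between a sum over objects of support exactly of size `j` and the
sums over objects with support inside a given set. -/
theorem sum_filter_card_eq {ι : Type} [Fintype ι] (s : ι → Finset (Fin n)) (f : ι → ℂ) (j : ℕ) :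
    ∑ a with (s a).card = j, f a =
      ∑ k ∈ Finset.range (j + 1), (-1 : ℂ) ^ (j - k) * ((n - k).choose (j - k) : ℂ) *
        ∑ T : Finset (Fin n) with T.card = k, ∑ a with s a ⊆ T, f a := by
  symm
  calc _ = ∑ k ∈ Finset.range (j + 1), ∑ T : Finset (Fin n) with T.card = k,
        ∑ R : Finset (Fin n) with R.card = j ∧ T ⊆ R,
          (-1 : ℂ) ^ (j - T.card) * ∑ a with s a ⊆ T, f a := by
        refine Finset.sum_congr rfl fun k hk => ?_
        rw [Finset.mul_sum]
        refine Finset.sum_congr rfl fun T hT => ?_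
        have hT : T.card = k := by simpa using hT
        rw [Finset.sum_const, card_filter_superset T (by have := Finset.mem_range.1 hk; omega), hT,
          nsmul_eq_mul]
        ring
    -- The bound `|T| ≤ j` can be dropped, since a larger `T` lies in no `R` of size `j`.
    _ = ∑ T : Finset (Fin n), ∑ R : Finset (Fin n) with R.card = j ∧ T ⊆ R,
          (-1 : ℂ) ^ (j - T.card) * ∑ a with s a ⊆ T, f a := by
        rw [Finset.sum_fiberwise_eq_sum_filter (g := Finset.card), Finset.sum_filter]
        refine Finset.sum_congr rfl fun T _ => ?_
        split_ifs with h
        · rfl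
        · rw [Finset.sum_eq_zero]
          intro R hR
          have hR := (Finset.mem_filter.1 hR).2
          have := Finset.card_le_card hR.2
          exact absurd (Finset.mem_range.2 (by omega)) h
    _ = ∑ R : Finset (Fin n) with R.card = j, ∑ T ∈ R.powerset,
          (-1 : ℂ) ^ (R.card - T.card) * ∑ a, f a * if s a ⊆ T then 1 else 0 := by
        rw [Finset.sum_comm' (s' := fun R => R.powerset)
          (t' := Finset.univ.filter fun R => R.card = j) (by simp [and_comm])]
        refine Finset.sum_congr rfl fun R hR => Finset.sum_congr rfl fun T _ => ?_
        have hR : R.card = j := by simpa using hR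
        rw [hR, Finset.sum_filter]
        simp
    _ = ∑ R : Finset (Fin n) with R.card = j, ∑ a, f a * if s a = R then 1 else 0 := by
        refine Finset.sum_congr rfl fun R _ => ?_
        simp only [Finset.mul_sum]
        rw [Finset.sum_comm]
        refine Finset.sum_congr rfl fun a _ => ?_
        rw [← sum_powerset_neg_one_pow_ite, Finset.mul_sum]
        exact Finset.sum_congr rfl fun T _ => by ring
    _ = _ := by
        rw [Finset.sum_comm, Finset.sum_filter]
        refine Finset.sum_congr rfl fun a _ => ?_
        rw [← Finset.mul_sum]
        simp

end Inversion

/-! ### Completeness of the error basis. -/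

section ErrorBasis

variable {n d : ℕ} {e : Fin (d ^ 2) → Matrix (Fin d) (Fin d) ℂ}

/-- The identity needs an index in `Fin (d ^ 2)`, which is empty for `d = 0`. -/
theorem IsErrorBasis.dim_ne_zero (he : IsErrorBasis e) : (d : ℂ) ≠ 0 := by
  rintro h
  obtain rfl : d = 0 := by exact_mod_cast h
  obtain ⟨j, -⟩ := he.one_mem
  exact absurd j.2 (by simp)

theorem IsErrorBasis.injective (he : IsErrorBasis e) : Function.Injective e := by
  intro a b hab
  by_contra hne
  have h1 := he.orthogonal a b
  have h2 := he.orthogonal a a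
  rw [if_neg hne, ← hab] at h1
  rw [if_pos rfl, h1] at h2
  exact he.dim_ne_zero h2.symm

/-- `∑ₐ eₐ ⊗ ēₐ` is `d` times the unnormalized maximally entangled operator. -/
theorem IsErrorBasis.complete (he : IsErrorBasis e) (x y w z : Fin d) :
    ∑ a, e a x y * star (e a w z) = if x = w ∧ y = z then (d : ℂ) else 0 := by
  have hd := he.dim_ne_zero
  -- Orthogonality reads `M * N = 1`. Both index types have `d ^ 2` elements, so `N * M = 1` too,
  -- and this is completeness.
  let M : Matrix (Fin (d ^ 2)) (Fin d × Fin d) ℂ := Matrix.of fun a p => star (e a p.1 p.2)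
  let N : Matrix (Fin d × Fin d) (Fin (d ^ 2)) ℂ := Matrix.of fun p a => (d : ℂ)⁻¹ * e a p.1 p.2
  have hMN : M * N = 1 := by
    ext a b
    have h := he.orthogonal a b
    rw [Matrix.trace_mul_comm, Matrix.trace] at h
    simp only [Matrix.diag_apply, Matrix.mul_apply, Matrix.conjTranspose_apply] at h
    have : (M * N) a b = (d : ℂ)⁻¹ * ∑ i, ∑ j, e b i j * star (e a i j) := by
      simp only [Matrix.mul_apply, M, N, Matrix.of_apply, Fintype.sum_prod_type, Finset.mul_sum]
      exact Finset.sum_congr rfl fun i _ => Finset.sum_congr rfl fun j _ => by ring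
    rw [this, h, Matrix.one_apply]
    split_ifs <;> simp [hd]
  have hcard : Fintype.card (Fin (d ^ 2)) = Fintype.card (Fin d × Fin d) := by simp [pow_two]
  have hNM : N * M = 1 := (Matrix.mul_eq_one_comm_of_card_eq _ _ _ hcard).1 hMN
  have h := congrFun (congrFun hNM (x, y)) (w, z)
  rw [Matrix.mul_apply] at h
  simp only [M, N, Matrix.of_apply, mul_assoc, ← Finset.mul_sum, Matrix.one_apply,
    Prod.mk.injEq] at h
  rw [inv_mul_eq_iff_eq_mul₀ hd] at h
  rw [h]
  split_ifs <;> simp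

open Classical in
/-- The positions at which `E_α` differs from the identity. -/
noncomputable def errorSupp (e : Fin (d ^ 2) → Matrix (Fin d) (Fin d) ℂ)
    (α : Fin n → Fin (d ^ 2)) : Finset (Fin n) :=
  Finset.univ.filter fun i => e (α i) ≠ 1

/-- Summing `E_α ⊗ Ē_α` over the errors supported in `T` gives `d ^ |T|` times the operator that
pairs the indices across at the positions in `T` and within each factor elsewhere. -/
theorem IsErrorBasis.sum_errorOp_mul_star (he : IsErrorBasis e) (T : Finset (Fin n))
    (x y w z : Fin n → Fin d) :
    ∑ α : Fin n → Fin (d ^ 2) with errorSupp e α ⊆ T, errorOp e α x y * star (errorOp e α w z) =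
      if x = T.piecewise w y ∧ z = T.piecewise y w then (d : ℂ) ^ T.card else 0 := by
  obtain ⟨a₀, ha₀⟩ := he.one_mem
  -- By injectivity of `e`, being supported in `T` means that `α i = a₀` off `T` and is free on `T`.
  -- The sum therefore factorizes over positions.
  have hset : (Finset.univ.filter fun α : Fin n → Fin (d ^ 2) => errorSupp e α ⊆ T) =
      Fintype.piFinset fun i => if i ∈ T then Finset.univ else {a₀} := by
    ext α
    simp only [Finset.mem_filter, Finset.mem_univ, true_and, Fintype.mem_piFinset]
    simp only [Finset.subset_iff, errorSupp, Finset.mem_filter, Finset.mem_univ, true_and]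
    refine forall_congr' fun i => ?_
    by_cases hi : i ∈ T
    · simp [hi]
    · simp [hi, ← ha₀, he.injective.eq_iff]
  have hprod : ∀ α, errorOp e α x y * star (errorOp e α w z) =
      ∏ i, e (α i) (x i) (y i) * star (e (α i) (w i) (z i)) := by
    intro α
    simp only [errorOp, tensorMatrix, Matrix.of_apply, star_prod, Finset.prod_mul_distrib]
  have hfac : ∀ i, ∑ a ∈ (if i ∈ T then Finset.univ else {a₀}),
      e a (x i) (y i) * star (e a (w i) (z i)) =
      if x i = T.piecewise w y i ∧ z i = T.piecewise y w i then (if i ∈ T then (d : ℂ) else 1)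
        else 0 := by
    intro i
    by_cases hi : i ∈ T
    · simp only [hi, if_true, he.complete, Finset.piecewise_eq_of_mem _ _ _ hi]
      exact if_congr (and_congr_right fun _ => eq_comm) rfl rfl
    · simp only [hi, if_false, Finset.sum_singleton, ha₀, Matrix.one_apply,
        Finset.piecewise_eq_of_notMem _ _ _ hi, @eq_comm _ (z i)]
      by_cases h1 : x i = y i <;> by_cases h2 : w i = z i <;> simp [h1, h2]
  rw [hset, Finset.sum_congr rfl fun α _ => hprod α,
    ← Finset.prod_univ_sum (fun i => if i ∈ T then Finset.univ else {a₀})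
      fun i a => e a (x i) (y i) * star (e a (w i) (z i))]
  simp only [hfac, Finset.prod_ite_zero, Finset.mem_univ, true_imp_iff, forall_and, funext_iff]
  simp [Finset.prod_ite_mem]

end ErrorBasis

/-! ### Enumerators as swap traces. -/

section Enumerators

variable {n d : ℕ} {e : Fin (d ^ 2) → Matrix (Fin d) (Fin d) ℂ}

theorem sum_ite_piecewise (ρ : Op n d) (T : Finset (Fin n)) (c : ℂ) :
    ∑ y, ∑ w, ∑ x, ∑ z, (if x = T.piecewise w y ∧ z = T.piecewise y w then c else 0) *
      (ρ y x * ρ w z) = c * swapTrace ρ ρ T := by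
  simp only [ite_and, ite_mul, zero_mul, Finset.sum_ite_irrel, Finset.sum_const_zero,
    Finset.sum_ite_eq', Finset.mem_univ, if_true]
  rw [swapTrace, Fintype.sum_prod_type, Finset.mul_sum]
  simp only [Finset.mul_sum]
  rfl

theorem swapTrace_compl (ρ : Op n d) (T : Finset (Fin n)) :
    swapTrace ρ ρ Tᶜ = ∑ y, ∑ w, ρ y (T.piecewise y w) * ρ w (T.piecewise w y) := by
  rw [swapTrace, Fintype.sum_prod_type]
  simp [swapAt, Finset.piecewise_compl]

theorem IsErrorBasis.sum_trace_mul_trace (he : IsErrorBasis e) (ρ : Op n d) (T : Finset (Fin n)) :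
    ∑ α : Fin n → Fin (d ^ 2) with errorSupp e α ⊆ T,
      (errorOp e α * ρ).trace * ((errorOp e α)ᴴ * ρ).trace =
        (d : ℂ) ^ T.card * swapTrace ρ ρ T := by
  have hα : ∀ α : Fin n → Fin (d ^ 2),
      (errorOp e α * ρ).trace * ((errorOp e α)ᴴ * ρ).trace = ∑ y, ∑ w, ∑ x, ∑ z,
        errorOp e α x y * star (errorOp e α w z) * (ρ y x * ρ w z) := by
    intro α
    rw [Matrix.trace_mul_comm, Matrix.trace_mul_comm (errorOp e α)ᴴ]
    simp only [Matrix.trace, Matrix.diag_apply, Matrix.mul_apply, Matrix.conjTranspose_apply]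
    rw [Finset.sum_mul_sum]
    refine Finset.sum_congr rfl fun y _ => Finset.sum_congr rfl fun w _ => ?_
    rw [Finset.sum_mul_sum]
    exact Finset.sum_congr rfl fun x _ => Finset.sum_congr rfl fun z _ => by ring
  rw [← sum_ite_piecewise, Finset.sum_congr rfl fun α _ => hα α, Finset.sum_comm]
  refine Finset.sum_congr rfl fun y _ => ?_
  rw [Finset.sum_comm]
  refine Finset.sum_congr rfl fun w _ => ?_
  rw [Finset.sum_comm]
  refine Finset.sum_congr rfl fun x _ => ?_
  rw [Finset.sum_comm]
  refine Finset.sum_congr rfl fun z _ => ?_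
  rw [← he.sum_errorOp_mul_star, Finset.sum_mul]

/-- Here the outer indices of `E` and `E†` are joined through `ρ` crosswise, compared with the
product of two traces. The same pairing of indices thus leaves the positions in `T` unswapped and
swaps those outside. -/
theorem IsErrorBasis.sum_trace_conj (he : IsErrorBasis e) (ρ : Op n d) (T : Finset (Fin n)) :
    ∑ α : Fin n → Fin (d ^ 2) with errorSupp e α ⊆ T,
      (errorOp e α * ρ * (errorOp e α)ᴴ * ρ).trace =
        (d : ℂ) ^ T.card * swapTrace ρ ρ Tᶜ := by
  have hα : ∀ α : Fin n → Fin (d ^ 2),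
      (errorOp e α * ρ * (errorOp e α)ᴴ * ρ).trace = ∑ y, ∑ w, ∑ x, ∑ z,
        errorOp e α x y * star (errorOp e α w z) * (ρ y z * ρ w x) := by
    intro α
    simp only [Matrix.trace, Matrix.diag_apply, Matrix.mul_apply, Matrix.conjTranspose_apply,
      Finset.sum_mul]
    rw [Finset.sum_comm]
    conv_rhs => rw [Finset.sum_comm]
    refine Finset.sum_congr rfl fun w _ => ?_
    rw [Finset.sum_congr rfl fun x _ => Finset.sum_comm, Finset.sum_comm]
    exact Finset.sum_congr rfl fun y _ => Finset.sum_congr rfl fun x _ =>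
      Finset.sum_congr rfl fun z _ => by ring
  rw [Finset.sum_congr rfl fun α _ => hα α, swapTrace_compl, Finset.mul_sum, Finset.sum_comm]
  refine Finset.sum_congr rfl fun y _ => ?_
  rw [Finset.sum_comm, Finset.mul_sum]
  refine Finset.sum_congr rfl fun w _ => ?_
  rw [Finset.sum_comm]
  rw [Finset.sum_congr rfl fun x _ => Finset.sum_comm]
  simp only [← Finset.sum_mul, he.sum_errorOp_mul_star]
  simp only [ite_and, ite_mul, zero_mul, Finset.sum_ite_irrel, Finset.sum_const_zero,
    Finset.sum_ite_eq', Finset.mem_univ, if_true]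

/-- Inversion for sums over the errors of weight `j`, from the sums over the errors supported in a
given set. -/
theorem sum_errorWt_eq (f : (Fin n → Fin (d ^ 2)) → ℂ) (g : Finset (Fin n) → ℂ)
    (hfg : ∀ T, ∑ α : Fin n → Fin (d ^ 2) with errorSupp e α ⊆ T, f α = (d : ℂ) ^ T.card * g T)
    (j : ℕ) :
    ∑ α : Fin n → Fin (d ^ 2) with errorWt e α = j, f α =
      ∑ k ∈ Finset.range (j + 1), (-1 : ℂ) ^ (j - k) * ((n - k).choose (j - k) : ℂ) * (d : ℂ) ^ k *
        ∑ T : Finset (Fin n) with T.card = k, g T := by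
  refine (sum_filter_card_eq (errorSupp e) f j).trans (Finset.sum_congr rfl fun k _ => ?_)
  rw [mul_assoc _ ((d : ℂ) ^ k), Finset.mul_sum (a := (d : ℂ) ^ k)]
  congr 1
  refine Finset.sum_congr rfl fun T hT => ?_
  rw [hfg, (Finset.mem_filter.1 hT).2]

end Enumerators

end SwapTest

theorem theorem2 (n d K δ : ℕ)
    (e : Fin (d ^ 2) → Matrix (Fin d) (Fin d) ℂ) (he : SwapTest.IsErrorBasis e)
    (Q : Submodule ℂ (SwapTest.Hilb n d)) (hQ : SwapTest.IsQECC e Q K δ)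
    (j : ℕ) (hj : j ≤ n) :
    SwapTest.shorLaflammeA e (SwapTest.codeState Q) j =
        ∑ k ∈ Finset.range (j + 1), (-1 : ℂ) ^ (j - k) * ((n - k).choose (j - k) : ℂ) * (d : ℂ) ^ k *
          ∑ t : SwapTest.Bits n with SwapTest.bitWt t = k, ∑ z : SwapTest.Bits n,
            (-1 : ℂ) ^ SwapTest.bitDot z t *
              (SwapTest.prob (SwapTest.codeState Q) (SwapTest.codeState Q) z : ℂ) ∧
    SwapTest.shorLaflammeB e (SwapTest.codeState Q) j =
        ∑ k ∈ Finset.range (j + 1), (-1 : ℂ) ^ (j - k) * ((n - k).choose (j - k) : ℂ) * (d : ℂ) ^ k *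
          ∑ t : SwapTest.Bits n with SwapTest.bitWt t = n - k, ∑ z : SwapTest.Bits n,
            (-1 : ℂ) ^ SwapTest.bitDot z t *
              (SwapTest.prob (SwapTest.codeState Q) (SwapTest.codeState Q) z : ℂ) ∧
    SwapTest.rainsA (SwapTest.codeState Q) j =
        ∑ t : SwapTest.Bits n with SwapTest.bitWt t = j, ∑ z : SwapTest.Bits n,
          (-1 : ℂ) ^ SwapTest.bitDot z t *
            (SwapTest.prob (SwapTest.codeState Q) (SwapTest.codeState Q) z : ℂ) ∧
    SwapTest.rainsB (SwapTest.codeState Q) j =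
        ∑ t : SwapTest.Bits n with SwapTest.bitWt t = n - j, ∑ z : SwapTest.Bits n,
          (-1 : ℂ) ^ SwapTest.bitDot z t *
            (SwapTest.prob (SwapTest.codeState Q) (SwapTest.codeState Q) z : ℂ) := by

  have hρ := SwapTest.isHermitian_codeState Q
  simp only [SwapTest.sum_neg_one_pow_mul_prob hρ hρ, SwapTest.sum_bitWt_eq]
  generalize SwapTest.codeState Q = ρ
  refine ⟨SwapTest.sum_errorWt_eq _ _ (he.sum_trace_mul_trace ρ) j, ?_, ?_, ?_⟩
  · refine (SwapTest.sum_errorWt_eq _ _ (he.sum_trace_conj ρ) j).trans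
      (Finset.sum_congr rfl fun k hk => ?_)
    -- Complements of the `k`-subsets are the `(n - k)`-subsets, as `k ≤ j ≤ n`.
    rw [SwapTest.sum_compl_card _ (by have := Finset.mem_range.1 hk; omega)]
  · simp only [SwapTest.rainsA, SwapTest.trace_reduced_sq]
  · simp only [SwapTest.rainsB, SwapTest.trace_reduced_sq]
    exact SwapTest.sum_compl_card _ hj
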